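/- For $k\ge 1$ let $(\mathbb R^n)^k$ carry the Euclidean product metric and let $\mathrm{vol}^\times_{(\mathbb R^n)^k}=\sum_{i=1}^k \pi_i^*\mathrm{vol}_{\mathbb R^n}$, where $\pi_i\colon(\mathbb R^n)^k\to\mathbb R^n$ is the projection to the $i$-th factor and $\mathrm{vol}_{\mathbb R^n}$ is the standard volume form. For $K\ge 1$ and a smooth closed non-vanishing $n$-form $\omega$ on $(\mathbb R^n)^k$, a continuous map $F\colon\mathbb R^n\to(\mathbb R^n)^k$ is called a $K$-quasiregular $\omega$-curve if $F\in W^{1,n}_{\mathrm{loc}}(\mathbb R^n,(\mathbb R^n)^k)$ and $$(\|\omega\|\circ F)\,\|DF\|^n\le K\,(\star F^*\omega)\quad\text{almost everywhere in }\mathbb R^n,$$ where $DF$ is the weak differential of $F$, $\|DF\|$ is its operator norm, $\|\omega\|$ is the pointwise comass norm $\|\omega_p\|=\max\{\omega_p(v_1,\ldots,v_n):|v_1|\le1,\ldots,|v_n|\le1\}$, and $\star$ is the Hodge star operator. The map $F$ is called a quasiregular $\omega$-curve if it is a $K$-quasiregular $\omega$-curve for some $K\ge1$. Theorem. For each $n\ge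 3$ there exist $k\in\mathbb N$ and a non-constant quasiregular $\mathrm{vol}^\times_{(\mathbb R^n)^k}$-curve $F\colon\mathbb R^n\to(\mathbb R^n)^k$ that is constant in the closed lower half-space $\mathbb R^{n-1}\times(-\infty,0]$. Moreover, no non-constant quasiregular $\mathrm{vol}^\times_{(\mathbb R^n)^k}$-curve $F\colon\mathbb R^n\to(\mathbb R^n)^k$, $k\in\mathbb N$, that is constant in $\mathbb R^{n-1}\times(-\infty,0]$ is discrete, that is, not every fiber $F^{-1}\{y\}$, $y\in(\mathbb R^n)^k$, of such a curve is a discrete set. -/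

import Mathlib

open MeasureTheory
open scoped ENNReal

noncomputable section

namespace QRCurve

/-- Euclidean space `ℝⁿ`. -/
abbrev Euc (n : ℕ) : Type := EuclideanSpace ℝ (Fin n)

/-- The Riemannian product `(ℝⁿ)ᵏ`, with the product inner product
`⟪x, y⟫ = ∑ i, ⟪x i, y i⟫`. -/
abbrev EucProd (n k : ℕ) : Type := PiLp 2 (fun _ : Fin k => Euc n)

/-- The Riemannian volume form of `ℝⁿ` with its standard orientation:
`(v₁, …, vₙ) ↦ det (v₁, …, vₙ)`. -/
def volForm (n : ℕ) : Euc n [⋀^Fin n]→L[ℝ] ℝ :=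
  { (EuclideanSpace.basisFun (Fin n) ℝ).toBasis.det with
    cont := by
      change Continuous fun v : Fin n → Euc n =>
        (EuclideanSpace.basisFun (Fin n) ℝ).toBasis.det v
      simp only [Module.Basis.det_apply]
      refine Continuous.matrix_det (continuous_matrix fun i j => ?_)
      simp only [Module.Basis.toMatrix_apply, OrthonormalBasis.coe_toBasis_repr_apply,
        EuclideanSpace.basisFun_repr]
      fun_prop }

/-- The `n`-form `vol^× = ∑ i, πᵢ^* vol_{ℝⁿ}` on `(ℝⁿ)ᵏ`, where `πᵢ` is the projection to the
`i`-th factor. It has constant coefficients. -/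
def volProd (n k : ℕ) : EucProd n k → EucProd n k [⋀^Fin n]→L[ℝ] ℝ :=
  fun _ => ∑ i : Fin k, (volForm n).compContinuousLinearMap
    (PiLp.proj 2 (fun _ : Fin k => Euc n) i)

section General

variable {n : ℕ} {V : Type*} [NormedAddCommGroup V] [InnerProductSpace ℝ V]
  [FiniteDimensional ℝ V]

/-- The comass norm of an `n`-covector: the maximum of `η (v₁, …, vₙ)` over vectors of length at
most one (the values form a compact set, so the supremum is attained). -/
def comass (η : V [⋀^Fin n]→L[ℝ] ℝ) : ℝ :=
  sSup {r : ℝ | ∃ v : Fin n → V, (∀ i, ‖v i‖ ≤ 1) ∧ η v = r}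

/-- The Hodge star of an `n`-covector on the oriented space `ℝⁿ`: the number `⋆η` with
`η = (⋆η) vol`, that is, the value of `η` at the standard basis. -/
def hodgeStar (η : Euc n [⋀^Fin n]→L[ℝ] ℝ) : ℝ :=
  η (fun i => EuclideanSpace.basisFun (Fin n) ℝ i)

/-- `DF` is a weak (distributional) differential of `F : ℝⁿ → V`. -/
structure HasWeakDifferential (F : Euc n → V) (DF : Euc n → Euc n →L[ℝ] V) : Prop where
  locallyIntegrable : LocallyIntegrable F volume
  locallyIntegrable_differential : LocallyIntegrable DF volume
  integral_eq : ∀ φ : Euc n → ℝ, ContDiff ℝ (⊤ : ℕ∞) φ → HasCompactSupport φ → ∀ v : Euc n,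
    ∫ x, (fderiv ℝ φ x v) • F x = - ∫ x, φ x • DF x v

/-- `F` belongs to `W^{1,p}_loc(ℝⁿ, V)` and `DF` is its weak differential (which is unique up to
a set of measure zero). -/
structure MemSobolevLocWith (p : ℝ≥0∞) (F : Euc n → V) (DF : Euc n → Euc n →L[ℝ] V) :
    Prop where
  hasWeakDifferential : HasWeakDifferential F DF
  memLp : ∀ S : Set (Euc n), IsCompact S → MemLp F p (volume.restrict S)
  memLp_differential : ∀ S : Set (Euc n), IsCompact S → MemLp DF p (volume.restrict S)

/-- `F : ℝⁿ → V` is a `K`-quasiregular `ω`-curve: `K ≥ 1`, `ω` is a smooth closed non-vanishing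
`n`-form on `V`, `F` is continuous and in `W^{1,n}_loc`, and
`(‖ω‖ ∘ F) ‖DF‖ⁿ ≤ K (⋆ F^*ω)` almost everywhere, where `‖ω‖` is the pointwise comass norm and
`‖DF‖` is the operator norm. -/
structure IsKQuasiregularCurve (K : ℝ) (ω : V → V [⋀^Fin n]→L[ℝ] ℝ) (F : Euc n → V) :
    Prop where
  one_le : 1 ≤ K
  smooth : ContDiff ℝ (⊤ : ℕ∞) ω
  closed : ∀ y, extDeriv ω y = 0
  nonvanishing : ∀ y, ω y ≠ 0
  continuous : Continuous F
  distortion : ∃ DF : Euc n → Euc n →L[ℝ] V, MemSobolevLocWith (n : ℝ≥0∞) F DF ∧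
    ∀ᵐ x ∂(volume : Measure (Euc n)),
      comass (ω (F x)) * ‖DF x‖ ^ n
        ≤ K * hodgeStar ((ω (F x)).compContinuousLinearMap (DF x))

/-- A quasiregular `ω`-curve is a `K`-quasiregular `ω`-curve for some `K ≥ 1`. -/
def IsQuasiregularCurve (ω : V → V [⋀^Fin n]→L[ℝ] ℝ) (F : Euc n → V) : Prop :=
  ∃ K : ℝ, IsKQuasiregularCurve K ω F

end General

/-- A map is constant on the set `S`. -/
def IsConstantOn {X Y : Type*} (F : X → Y) (S : Set X) : Prop :=
  ∃ c : Y, ∀ x ∈ S, F x = c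

/-- A map is discrete if each of its fibers is a discrete set. -/
def IsDiscreteMap {X Y : Type*} [TopologicalSpace X] (F : X → Y) : Prop :=
  ∀ y : Y, DiscreteTopology ↥(F ⁻¹' {y})

/-- The closed lower half-space `ℝⁿ⁻¹ × (-∞, 0]` of `ℝⁿ`: the last coordinate is nonpositive. -/
def lowerHalfSpace (n : ℕ) : Set (Euc n) :=
  {x | ∀ i : Fin n, (i : ℕ) + 1 = n → x i ≤ 0}

end QRCurve

end

open MeasureTheory
open scoped ENNReal

noncomputable section

namespace QRCurve

/-! Write n = N + 1, with x the first N coordinates and t the last. For a cutoff ρ supported in 1 ≤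
t ≤ 4 consider the map with coordinates ρ(t) sin x_j and ρ(t) ∏ cos x_i. Its Jacobian is ρ'ρ^N times
a sum of N + 1 products of squared sines and cosines (`jacobian_waveDeriv`). Shifting each x_i by 0
or π/2 gives 2^N such maps, and because sin² + cos² = 1 their Jacobians add up to (N + 1) ρ'ρ^N, a
function of t alone (`sum_jacobian_waveDeriv`).

Rescaled copies s⁶ · wave(p/s), with s running over all powers of 4, fill the upper half-space and
vanish to sixth order at its boundary, so extension by zero stays differentiable
(`hasFDerivAt_tower`). The summed Jacobian is still negative in the upper part of each slab, where
ρ' < 0. A second tower, dilated by a factor 2, is added as further components. Differentials grow by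
32 when t doubles, so wherever one tower is descending the other dominates by a uniform factor
(`cutoffJac_add_pos`, `componentDeriv_estimate`). At height t all differentials are thus O(w) for
one weight w, while the summed Jacobian is at least a constant times w^n, which is the distortion
inequality.

Non-discreteness is topological: a single fiber contains the whole half-space, which is connected
and has more than one point. -/

/-! ### Determinants of arrow matrices -/

open Finset in
/-- Determinant of an arrow matrix: a diagonal matrix bordered by one column and one row. -/
theorem det_fromBlocks_diagonal {N : ℕ} (d u v : Fin N → ℝ) (α : ℝ) :
    (Matrix.fromBlocks (Matrix.diagonal d) (Matrix.of fun i (_ : Fin 1) => u i)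
      (Matrix.of fun (_ : Fin 1) i => v i) (Matrix.of fun _ _ => α)).det
      = α * ∏ i, d i - ∑ j, u j * v j * ∏ i, (if i = j then 1 else d i) := by
  suffices h : (fun d : Fin N → ℝ => (Matrix.fromBlocks (Matrix.diagonal d)
      (Matrix.of fun i (_ : Fin 1) => u i) (Matrix.of fun (_ : Fin 1) i => v i)
      (Matrix.of fun _ _ => α)).det)
      = fun d => α * ∏ i, d i - ∑ j, u j * v j * ∏ i, (if i = j then 1 else d i) from congrFun h d
  have hdense : Dense (Set.pi Set.univ fun _ : Fin N => ({0}ᶜ : Set ℝ)) :=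
    dense_pi Set.univ fun i _ => (dense_compl_singleton (0 : ℝ))
  -- Both sides are continuous in `d`, so it suffices to treat nowhere vanishing `d`, where the
  -- Schur complement of the diagonal block is available.
  refine Continuous.ext_on hdense ?_ ?_ ?_
  · refine Continuous.matrix_det (continuous_matrix fun i j => ?_)
    rcases i with i | i <;> rcases j with j | j
    · by_cases h : i = j
      · subst h; simpa using continuous_apply i
      · simpa [Matrix.diagonal_apply_ne _ h] using continuous_const
    all_goals simpa using continuous_const
  · refine Continuous.sub (by fun_prop) (continuous_finsetSum _ fun j _ => ?_)
    refine Continuous.mul (by fun_prop) (continuous_finsetProd _ fun i _ => ?_)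
    by_cases h : i = j
    · simpa [h] using continuous_const
    · simpa [h] using continuous_apply i
  · intro d hd
    have hd0 : ∀ i, d i ≠ 0 := fun i => hd i (Set.mem_univ i)
    let _ : Invertible d := ⟨fun i => (d i)⁻¹, by ext i; simp [hd0 i], by ext i; simp [hd0 i]⟩
    let _ : Invertible (Matrix.diagonal d) := Matrix.diagonalInvertible d
    have hI : ⅟ (Matrix.diagonal d) = Matrix.diagonal (fun i => (d i)⁻¹) := rfl
    beta_reduce
    rw [Matrix.det_fromBlocks₁₁, hI, Matrix.det_diagonal, Matrix.det_fin_one]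
    simp only [Matrix.sub_apply, Matrix.of_apply, Matrix.mul_apply, Matrix.diagonal_apply,
      mul_ite, mul_zero, sum_ite_eq', mem_univ, if_true]
    rw [mul_sub, mul_comm, mul_sum]
    congr 1
    refine sum_congr rfl fun j _ => ?_
    have h1 : ∏ i, d i = d j * ∏ i, (if i = j then 1 else d i) := by
      rw [← mul_prod_erase univ d (mem_univ j), ← mul_prod_erase univ (fun i => ite _ _ _)
        (mem_univ j)]
      simp only [if_true, one_mul]
      congr 1
      exact prod_congr rfl fun i hi => by simp [ne_of_mem_erase hi]
    rw [h1]
    field_simp [hd0 j]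

/-! ### The cutoff and the positivity of two interlaced profiles -/

/-- A `C¹` cutoff function, positive exactly on `(1, 4)`. -/
def cutoff (t : ℝ) : ℝ := max 0 ((t - 1) * (4 - t)) ^ 2

/-- The derivative of `cutoff`. -/
def cutoffDeriv (t : ℝ) : ℝ := 2 * max 0 ((t - 1) * (4 - t)) * (5 - 2 * t)

theorem hasDerivAt_max_zero_sq (y : ℝ) :
    HasDerivAt (fun y : ℝ => max 0 y ^ 2) (2 * max 0 y) y := by
  rcases lt_trichotomy y 0 with h | rfl | h
  · have : (fun y : ℝ => max 0 y ^ 2) =ᶠ[nhds y] fun _ => 0 := by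
      filter_upwards [gt_mem_nhds h] with z hz
      simp [hz.le]
    simpa [h.le] using (hasDerivAt_const y (0 : ℝ)).congr_of_eventuallyEq this
  · have : HasFDerivAt (fun y : ℝ => max 0 y ^ 2) (0 : ℝ →L[ℝ] ℝ) 0 := by
      refine Asymptotics.IsBigO.hasFDerivAt (n := 2) (Asymptotics.IsBigO.of_bound 1 ?_) (by norm_num)
      refine Filter.Eventually.of_forall fun z => ?_
      have : max 0 z ≤ |z| := max_le (abs_nonneg z) (le_abs_self z)
      have h0 : 0 ≤ max 0 z := le_max_left _ _
      simp only [norm_pow, Real.norm_eq_abs, sub_zero, abs_abs, one_mul, abs_of_nonneg h0]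
      gcongr
    simpa using this.hasDerivAt
  · have : (fun y : ℝ => max 0 y ^ 2) =ᶠ[nhds y] fun y => y ^ 2 := by
      filter_upwards [lt_mem_nhds h] with z hz
      simp [hz.le]
    simpa [h.le] using (hasDerivAt_pow 2 y).congr_of_eventuallyEq this

theorem hasDerivAt_cutoff (t : ℝ) : HasDerivAt cutoff (cutoffDeriv t) t := by
  have h1 : HasDerivAt (fun t : ℝ => (t - 1) * (4 - t)) (5 - 2 * t) t := by
    convert! ((hasDerivAt_id t).sub_const 1).mul ((hasDerivAt_id t).const_sub 4) using 1
    simp; ring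
  exact (hasDerivAt_max_zero_sq _).comp t h1

theorem cutoff_eq_zero {t : ℝ} (h : t ≤ 1 ∨ 4 ≤ t) : cutoff t = 0 := by
  have : (t - 1) * (4 - t) ≤ 0 := by rcases h with h | h <;> nlinarith
  simp [cutoff, this]

theorem cutoffDeriv_eq_zero {t : ℝ} (h : t ≤ 1 ∨ 4 ≤ t) : cutoffDeriv t = 0 := by
  have : (t - 1) * (4 - t) ≤ 0 := by rcases h with h | h <;> nlinarith
  simp [cutoffDeriv, this]

theorem max_zero_le (t : ℝ) : max 0 ((t - 1) * (4 - t)) ≤ 9 / 4 :=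
  max_le (by norm_num) (by nlinarith [sq_nonneg (2 * t - 5)])

theorem abs_cutoff_le (t : ℝ) : |cutoff t| ≤ 14 := by
  have h := max_zero_le t
  have h0 : 0 ≤ max 0 ((t - 1) * (4 - t)) := le_max_left _ _
  rw [cutoff, abs_of_nonneg (by positivity)]
  nlinarith

theorem abs_cutoffDeriv_le (t : ℝ) : |cutoffDeriv t| ≤ 14 := by
  by_cases ht : t ≤ 1 ∨ 4 ≤ t
  · simp [cutoffDeriv_eq_zero ht]
  · push Not at ht
    have h := max_zero_le t
    have h0 : 0 ≤ max 0 ((t - 1) * (4 - t)) := le_max_left _ _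
    rw [cutoffDeriv, abs_le]
    constructor <;> nlinarith

/-- The radial factor of the Jacobian. -/
def cutoffJac (N : ℕ) (t : ℝ) : ℝ := cutoffDeriv t * cutoff t ^ N

theorem continuous_cutoffJac (N : ℕ) : Continuous (cutoffJac N) := by
  unfold cutoffJac cutoffDeriv cutoff
  fun_prop

theorem cutoffJac_eq (N : ℕ) (t : ℝ) :
    cutoffJac N t = 2 * (5 - 2 * t) * max 0 ((t - 1) * (4 - t)) ^ (2 * N + 1) := by
  rw [cutoffJac, cutoffDeriv, cutoff, ← pow_mul, pow_succ]; ring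

/-- The first term vanishes at t = 1 and the second is negative for 5/4 < t < 2. Below 5/4 both are
nonnegative and the second is positive; from 5/4 on the first is bounded away from zero and the
weight 1/32 makes the second negligible. -/
theorem cutoffJac_add_pos (N : ℕ) {t : ℝ} (h1 : 1 ≤ t) (h2 : t ≤ 2) :
    0 < cutoffJac N t + (1 / 32) ^ (N + 1) * cutoffJac N (2 * t) := by
  rw [cutoffJac_eq, cutoffJac_eq]
  rcases lt_or_ge t (5 / 4) with h | h
  · have hp : 0 < (2 * t - 1) * (4 - 2 * t) := by apply mul_pos <;> linarith
    have hm : 0 < max 0 ((2 * t - 1) * (4 - 2 * t)) := lt_max_of_lt_right hp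
    have ha : 0 < 5 - 2 * (2 * t) := by linarith
    have hb : 0 < 5 - 2 * t := by linarith
    have : 0 ≤ max 0 ((t - 1) * (4 - t)) := le_max_left _ _
    positivity
  · have hb : 1 ≤ 5 - 2 * t := by linarith
    set x := max 0 ((t - 1) * (4 - t)) with hx
    set y := max 0 ((2 * t - 1) * (4 - 2 * t)) with hy
    have hx1 : 9 / 16 ≤ x := le_max_of_le_right (by nlinarith)
    have hy1 : y ≤ 4 * x := (max_zero_le _).trans (by linarith)
    have hy0 : 0 ≤ y := le_max_left _ _
    have hyp : y ^ (2 * N + 1) ≤ 4 ^ (2 * N + 1) * x ^ (2 * N + 1) := by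
      rw [← mul_pow]; gcongr
    have hxp : 0 < x ^ (2 * N + 1) := by positivity
    -- The weight beats the ratio bound y ≤ 4x at every N: the loss is at most 6 · (1/8) x^(2N+1),
    -- the gain at least 2 x^(2N+1).
    have hc : (1 / 32 : ℝ) ^ (N + 1) * 4 ^ (2 * N + 1) ≤ 1 / 8 := by
      have : (1 / 32 : ℝ) ^ (N + 1) * 4 ^ (2 * N + 1) = (1 / 2) ^ N * (1 / 8) := by
        rw [pow_succ, pow_succ, pow_mul]
        have : (1 / 32 : ℝ) ^ N * (4 ^ 2) ^ N = (1 / 2) ^ N := by rw [← mul_pow]; norm_num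
        linear_combination (1 / 8) * this
      rw [this]
      have : (1 / 2 : ℝ) ^ N ≤ 1 := pow_le_one₀ (by norm_num) (by norm_num)
      linarith
    have hcy : (1 / 32 : ℝ) ^ (N + 1) * y ^ (2 * N + 1) ≤ 1 / 8 * x ^ (2 * N + 1) := by
      calc _ ≤ (1 / 32 : ℝ) ^ (N + 1) * (4 ^ (2 * N + 1) * x ^ (2 * N + 1)) := by gcongr
        _ = ((1 / 32 : ℝ) ^ (N + 1) * 4 ^ (2 * N + 1)) * x ^ (2 * N + 1) := by ring
        _ ≤ _ := by gcongr
    have hcy0 : 0 ≤ (1 / 32 : ℝ) ^ (N + 1) * y ^ (2 * N + 1) := by positivity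
    have e1 : -6 * ((1 / 32 : ℝ) ^ (N + 1) * y ^ (2 * N + 1))
        ≤ 2 * (5 - 2 * (2 * t)) * ((1 / 32 : ℝ) ^ (N + 1) * y ^ (2 * N + 1)) := by
      gcongr; linarith
    have e2 : 2 * x ^ (2 * N + 1) ≤ 2 * (5 - 2 * t) * x ^ (2 * N + 1) := by
      gcongr; linarith
    nlinarith

theorem exists_le_cutoffJac_add (N : ℕ) : ∃ δ : ℝ, 0 < δ ∧ ∀ t : ℝ, 1 ≤ t → t ≤ 2 →
    δ ≤ cutoffJac N t + (1 / 32) ^ (N + 1) * cutoffJac N (2 * t) := by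
  have hc : Continuous fun t : ℝ => cutoffJac N t + (1 / 32) ^ (N + 1) * cutoffJac N (2 * t) := by
    have := continuous_cutoffJac N
    fun_prop
  obtain ⟨t₀, ht₀, hmin⟩ := (isCompact_Icc (a := (1 : ℝ)) (b := 2)).exists_isMinOn
    ⟨1, by norm_num⟩ hc.continuousOn
  exact ⟨_, cutoffJac_add_pos N ht₀.1 ht₀.2, fun t h1 h2 => hmin ⟨h1, h2⟩⟩

/-! ### Averaging over phases -/

/-- A phase shift by a quarter period, or none. -/
def phase (b : Bool) : ℝ := if b then Real.pi / 2 else 0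

-- Each of the N + 1 products, summed over all S, factors into a product over coordinates. A
-- quarter-period shift exchanges sin² and cos², so every factor is sin² + cos² = 1.
open Finset in
theorem sum_prod_phase {N : ℕ} (x : Fin N → ℝ) :
    ∑ S : Fin N → Bool, ((∏ i, Real.cos (x i + phase (S i)) ^ 2)
      + ∑ j, ∏ i, if i = j then Real.sin (x i + phase (S i)) ^ 2
        else Real.cos (x i + phase (S i)) ^ 2) = N + 1 := by
  have key : ∀ T : Fin N → Bool → ℝ, (∀ i, T i true + T i false = 1) →
      ∑ S : Fin N → Bool, ∏ i, T i (S i) = 1 := by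
    intro T hT
    have := prod_univ_sum (fun _ : Fin N => (univ : Finset Bool)) T
    rw [Fintype.piFinset_univ] at this
    rw [← this]
    exact prod_eq_one fun i _ => by simpa using hT i
  rw [sum_add_distrib, sum_comm,
    key (fun i b => Real.cos (x i + phase b) ^ 2) (fun i => by simp [phase, Real.cos_add_pi_div_two])]
  have : ∀ j : Fin N, ∑ S : Fin N → Bool, (∏ i, if i = j then Real.sin (x i + phase (S i)) ^ 2
        else Real.cos (x i + phase (S i)) ^ 2) = 1 := fun j =>
    key (fun i b => if i = j then Real.sin (x i + phase b) ^ 2 else Real.cos (x i + phase b) ^ 2)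
      (fun i => by
        by_cases h : i = j <;> simp [h, phase, Real.cos_add_pi_div_two, Real.sin_add_pi_div_two])
  rw [sum_congr rfl fun j _ => this j]
  simp [add_comm]

theorem norm_le_sum_norm {ι : Type*} [Fintype ι] {β : ι → Type*}
    [∀ i, NormedAddCommGroup (β i)] (x : PiLp 2 β) : ‖x‖ ≤ ∑ i, ‖x i‖ := by
  rw [PiLp.norm_eq_of_L2]
  refine Real.sqrt_le_iff.2 ⟨by positivity, ?_⟩
  exact Finset.sum_sq_le_sq_sum_of_nonneg fun i _ => norm_nonneg _

/-! ### The oscillating map and its differential -/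

variable {N : ℕ}

/-- The coordinate functions of `wave`. -/
def waveCoord (S : Fin N → Bool) (p : Euc (N + 1)) : Fin (N + 1) → ℝ :=
  Fin.snoc (α := fun _ => ℝ)
    (fun j => cutoff (p (Fin.last N)) * Real.sin (p j.castSucc + phase (S j)))
    (cutoff (p (Fin.last N)) * ∏ i, Real.cos (p i.castSucc + phase (S i)))

/-- A map that oscillates in the first `N` coordinates and is cut off in the last one. -/
def wave (S : Fin N → Bool) (p : Euc (N + 1)) : Euc (N + 1) := WithLp.toLp 2 (waveCoord S p)

/-- The differentials of the coordinate functions of `wave`. -/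
def waveCoordDeriv (S : Fin N → Bool) (p : Euc (N + 1)) : Fin (N + 1) → Euc (N + 1) →L[ℝ] ℝ :=
  Fin.snoc (α := fun _ => Euc (N + 1) →L[ℝ] ℝ)
    (fun j => (cutoffDeriv (p (Fin.last N)) * Real.sin (p j.castSucc + phase (S j))) •
        EuclideanSpace.proj (Fin.last N)
      + (cutoff (p (Fin.last N)) * Real.cos (p j.castSucc + phase (S j))) •
        EuclideanSpace.proj j.castSucc)
    ((cutoffDeriv (p (Fin.last N)) * ∏ i, Real.cos (p i.castSucc + phase (S i))) •
        EuclideanSpace.proj (Fin.last N)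
      + cutoff (p (Fin.last N)) • ∑ j, (-Real.sin (p j.castSucc + phase (S j)) *
        ∏ i, if i = j then 1 else Real.cos (p i.castSucc + phase (S i))) •
        EuclideanSpace.proj j.castSucc)

/-- The differential of `wave`. -/
def waveDeriv (S : Fin N → Bool) (p : Euc (N + 1)) : Euc (N + 1) →L[ℝ] Euc (N + 1) :=
  ((PiLp.continuousLinearEquiv 2 ℝ fun _ : Fin (N + 1) => ℝ).symm : _ →L[ℝ] Euc (N + 1)) ∘L
    ContinuousLinearMap.pi (waveCoordDeriv S p)

theorem waveDeriv_apply (S : Fin N → Bool) (p v : Euc (N + 1)) (j : Fin (N + 1)) :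
    waveDeriv S p v j = waveCoordDeriv S p j v := rfl

theorem prod_erase_eq_prod_ite (j : Fin N) (f : Fin N → ℝ) :
    ∏ i ∈ Finset.univ.erase j, f i = ∏ i, if i = j then 1 else f i := by
  rw [← Finset.mul_prod_erase Finset.univ (fun i => ite _ _ _) (Finset.mem_univ j)]
  simp only [if_true, one_mul]
  exact Finset.prod_congr rfl fun i hi => by simp [Finset.ne_of_mem_erase hi]

theorem hasFDerivAt_coord (p : Euc (N + 1)) (i : Fin (N + 1)) :
    HasFDerivAt (fun p : Euc (N + 1) => p i) (EuclideanSpace.proj i : Euc (N + 1) →L[ℝ] ℝ) p :=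
  (EuclideanSpace.proj i : Euc (N + 1) →L[ℝ] ℝ).hasFDerivAt

theorem hasFDerivAt_wave (S : Fin N → Bool) (p : Euc (N + 1)) :
    HasFDerivAt (wave S) (waveDeriv S p) p := by
  have hcut := (hasDerivAt_cutoff (p (Fin.last N))).comp_hasFDerivAt p
    (hasFDerivAt_coord p (Fin.last N))
  rw [← hasFDerivWithinAt_univ, hasFDerivWithinAt_euclidean]
  intro j
  rw [hasFDerivWithinAt_univ]
  have hrow : (EuclideanSpace.proj j).comp (waveDeriv S p) = waveCoordDeriv S p j := by
    ext v; rfl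
  rw [show PiLp.proj 2 (fun _ : Fin (N + 1) => ℝ) j ∘L waveDeriv S p = waveCoordDeriv S p j from
    hrow]
  induction j using Fin.lastCases with
  | last =>
    have hc : ∀ i ∈ Finset.univ, HasFDerivAt
        (fun p : Euc (N + 1) => Real.cos (p (Fin.castSucc i) + phase (S i)))
        (-Real.sin (p (Fin.castSucc i) + phase (S i)) • EuclideanSpace.proj (Fin.castSucc i)) p :=
      fun i _ => (Real.hasDerivAt_cos _).comp_hasFDerivAt p
        ((hasFDerivAt_coord p (Fin.castSucc i)).add_const _)
    have := hcut.mul (HasFDerivAt.finsetProd hc)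
    simp only [wave, waveCoord, waveCoordDeriv, Fin.snoc_last]
    refine this.congr_fderiv ?_
    ext v
    simp only [prod_erase_eq_prod_ite, add_apply,
      smul_apply, smul_eq_mul, sum_apply, Function.comp]
    rw [add_comm]
    congr 1
    · ring
    · congr 1
      exact Finset.sum_congr rfl fun i _ => by ring
  | cast j =>
    have hs := (Real.hasDerivAt_sin (p j.castSucc + phase (S j))).comp_hasFDerivAt p
      ((hasFDerivAt_coord p j.castSucc).add_const (phase (S j)))
    have := hcut.mul hs
    simp only [wave, waveCoord, waveCoordDeriv, Fin.snoc_castSucc]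
    refine this.congr_fderiv ?_
    ext v
    simp only [add_apply,
      smul_apply, smul_eq_mul, Function.comp]
    ring

theorem wave_eq_zero (S : Fin N → Bool) {p : Euc (N + 1)}
    (h : p (Fin.last N) ≤ 1 ∨ 4 ≤ p (Fin.last N)) : wave S p = 0 := by
  ext j
  induction j using Fin.lastCases <;> simp [wave, waveCoord, cutoff_eq_zero h]

theorem waveDeriv_eq_zero (S : Fin N → Bool) {p : Euc (N + 1)}
    (h : p (Fin.last N) ≤ 1 ∨ 4 ≤ p (Fin.last N)) : waveDeriv S p = 0 := by
  ext v j
  rw [waveDeriv_apply]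
  induction j using Fin.lastCases <;>
    simp [waveCoordDeriv, cutoff_eq_zero h, cutoffDeriv_eq_zero h]

theorem abs_prod_cos_le (x : Fin N → ℝ) : |∏ i, Real.cos (x i)| ≤ 1 := by
  rw [Finset.abs_prod]
  exact Finset.prod_le_one (fun _ _ => abs_nonneg _) fun i _ => Real.abs_cos_le_one _

theorem norm_wave_le (S : Fin N → Bool) (p : Euc (N + 1)) : ‖wave S p‖ ≤ (N + 1) * 14 := by
  have h : ∀ j, ‖wave S p j‖ ≤ 14 := by
    intro j
    have hc := abs_cutoff_le (p (Fin.last N))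
    induction j using Fin.lastCases with
    | last =>
      simp only [wave, waveCoord, Fin.snoc_last, Real.norm_eq_abs, abs_mul]
      exact (mul_le_of_le_one_right (abs_nonneg _) (abs_prod_cos_le _)).trans hc
    | cast j =>
      simp only [wave, waveCoord, Fin.snoc_castSucc, Real.norm_eq_abs, abs_mul]
      exact (mul_le_of_le_one_right (abs_nonneg _) (Real.abs_sin_le_one _)).trans hc
  calc ‖wave S p‖ ≤ ∑ j, ‖wave S p j‖ := norm_le_sum_norm _
    _ ≤ ∑ _j : Fin (N + 1), 14 := Finset.sum_le_sum fun j _ => h j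
    _ = _ := by simp

theorem norm_waveDeriv_le (S : Fin N → Bool) (p : Euc (N + 1)) :
    ‖waveDeriv S p‖ ≤ 28 * (N + 1) ^ 2 := by
  refine ContinuousLinearMap.opNorm_le_bound _ (by positivity) fun v => ?_
  have hv : ∀ i, |v i| ≤ ‖v‖ := fun i => PiLp.norm_apply_le v i
  have hc := abs_cutoff_le (p (Fin.last N))
  have hd := abs_cutoffDeriv_le (p (Fin.last N))
  have hterm : ∀ {a b : ℝ} (i : Fin (N + 1)), |a| ≤ 14 → |b| ≤ 1 → |a * b * v i| ≤ 14 * ‖v‖ := by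
    intro a b i ha hb
    rw [abs_mul, abs_mul]
    have : |a| * |b| ≤ 14 * 1 := by gcongr
    calc |a| * |b| * |v i| ≤ (14 * 1) * ‖v‖ := by gcongr; exact hv i
      _ = _ := by ring
  have hN : (0 : ℝ) ≤ N := Nat.cast_nonneg N
  have h : ∀ j, ‖waveDeriv S p v j‖ ≤ 28 * (N + 1) * ‖v‖ := by
    intro j
    rw [waveDeriv_apply, Real.norm_eq_abs]
    induction j using Fin.lastCases with
    | last =>
      simp only [waveCoordDeriv, Fin.snoc_last, add_apply,
        smul_apply, smul_eq_mul, sum_apply,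
        PiLp.proj_apply, Finset.mul_sum]
      refine (abs_add_le _ _).trans ?_
      have h1 := hterm (Fin.last N) hd
        (abs_prod_cos_le fun i : Fin N => p i.castSucc + phase (S i))
      have h2 : |∑ j : Fin N, cutoff (p (Fin.last N)) * (-Real.sin (p j.castSucc + phase (S j)) *
          (∏ i, if i = j then 1 else Real.cos (p i.castSucc + phase (S i))) * v j.castSucc)|
          ≤ ∑ _j : Fin N, 14 * ‖v‖ := by
        refine (Finset.abs_sum_le_sum_abs _ _).trans (Finset.sum_le_sum fun j _ => ?_)
        rw [← mul_assoc]
        refine hterm _ hc ?_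
        rw [abs_mul, abs_neg, ← one_mul (1 : ℝ)]
        refine mul_le_mul (Real.abs_sin_le_one _) ?_ (abs_nonneg _) zero_le_one
        rw [Finset.abs_prod]
        refine Finset.prod_le_one (fun _ _ => abs_nonneg _) fun i _ => ?_
        split_ifs
        · simp
        · exact Real.abs_cos_le_one _
      simp only [Finset.sum_const, Finset.card_univ, Fintype.card_fin, nsmul_eq_mul] at h2
      nlinarith [norm_nonneg v, mul_nonneg hN (norm_nonneg v)]
    | cast j =>
      simp only [waveCoordDeriv, Fin.snoc_castSucc, add_apply,
        smul_apply, smul_eq_mul, PiLp.proj_apply]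
      refine (abs_add_le _ _).trans ?_
      have h1 := hterm (Fin.last N) hd (Real.abs_sin_le_one (p j.castSucc + phase (S j)))
      have h2 := hterm j.castSucc hc (Real.abs_cos_le_one (p j.castSucc + phase (S j)))
      nlinarith [norm_nonneg v, mul_nonneg hN (norm_nonneg v)]
  calc ‖waveDeriv S p v‖ ≤ ∑ j, ‖waveDeriv S p v j‖ := norm_le_sum_norm _
    _ ≤ ∑ _j : Fin (N + 1), 28 * (N + 1) * ‖v‖ := Finset.sum_le_sum fun j _ => h j
    _ = _ := by simp; ring

/-! ### Jacobians -/

/-- The Jacobian determinant of a linear map of `ℝⁿ`. -/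
def jacobian {n : ℕ} (T : Euc n →L[ℝ] Euc n) : ℝ :=
  volForm n fun i => T (EuclideanSpace.basisFun (Fin n) ℝ i)

theorem jacobian_eq_det {n : ℕ} (T : Euc n →L[ℝ] Euc n) :
    jacobian T = (Matrix.of fun i j => T (EuclideanSpace.single j 1) i).det := by
  change (EuclideanSpace.basisFun (Fin n) ℝ).toBasis.det _ = _
  rw [Module.Basis.det_apply]
  congr 1
  ext i j
  simp [Module.Basis.toMatrix_apply]

theorem jacobian_smul {n : ℕ} (c : ℝ) (T : Euc n →L[ℝ] Euc n) :
    jacobian (c • T) = c ^ n * jacobian T := by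
  rw [jacobian_eq_det, jacobian_eq_det]
  have : (Matrix.of fun i j => (c • T) (EuclideanSpace.single j 1) i)
      = c • Matrix.of fun i j => T (EuclideanSpace.single j 1) i := by
    ext i j; simp
  rw [this, Matrix.det_smul, Fintype.card_fin]

/-- Each sine coordinate depends only on its own variable and the last one, so the matrix is an
arrow. The minus sign of cos' cancels the one in the arrow determinant, hence all terms enter with
the sign of ρ'. -/
theorem jacobian_waveDeriv (S : Fin N → Bool) (p : Euc (N + 1)) :
    jacobian (waveDeriv S p) = cutoffJac N (p (Fin.last N)) *
      ((∏ i, Real.cos (p (Fin.castSucc i) + phase (S i)) ^ 2)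
      + ∑ j, ∏ i, if i = j then Real.sin (p (Fin.castSucc i) + phase (S i)) ^ 2
        else Real.cos (p (Fin.castSucc i) + phase (S i)) ^ 2) := by
  set ρ := cutoff (p (Fin.last N)) with hρ
  set ρ' := cutoffDeriv (p (Fin.last N)) with hρ'
  set s : Fin N → ℝ := fun i => Real.sin (p (Fin.castSucc i) + phase (S i)) with hs
  set c : Fin N → ℝ := fun i => Real.cos (p (Fin.castSucc i) + phase (S i)) with hc
  have hdet : jacobian (waveDeriv S p) =
      (Matrix.fromBlocks (Matrix.diagonal fun i => ρ * c i)
        (Matrix.of fun i (_ : Fin 1) => ρ' * s i)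
        (Matrix.of fun (_ : Fin 1) j => ρ * (-s j * ∏ i, if i = j then 1 else c i))
        (Matrix.of fun _ _ => ρ' * ∏ i, c i)).det := by
    rw [jacobian_eq_det, ← Matrix.det_submatrix_equiv_self (finSumFinEquiv (m := N) (n := 1))]
    congr 1
    ext i j
    have hl : ∀ x : Fin 1, Fin.natAdd N x = Fin.last N := fun x => by ext; simp
    have hcs : ∀ x : Fin N, Fin.castAdd 1 x = x.castSucc := fun _ => rfl
    have hne : ∀ x : Fin N, Fin.last N ≠ x.castSucc := fun x => (Fin.castSucc_lt_last x).ne'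
    rcases i with i | i <;> rcases j with j | j
    · by_cases hij : i = j
      · simp [waveDeriv_apply, waveCoordDeriv, hcs, hij, hne, hρ, hc]
      · simp [waveDeriv_apply, waveCoordDeriv, hcs, hij, hne]
    · simp [waveDeriv_apply, waveCoordDeriv, hl, hcs, (hne _).symm, hs, hρ']
    · simp [waveDeriv_apply, waveCoordDeriv, hl, hcs, hne, hs, hρ, hc]
    · simp [waveDeriv_apply, waveCoordDeriv, hl, (hne _).symm, hρ', hc]
  rw [hdet, det_fromBlocks_diagonal, mul_add, Finset.mul_sum, sub_eq_add_neg,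
    ← Finset.sum_neg_distrib]
  congr 1
  · simp only [Finset.prod_mul_distrib, Finset.prod_const, Finset.card_univ, Fintype.card_fin,
      Finset.prod_pow]
    rw [cutoffJac]; ring
  · refine Finset.sum_congr rfl fun j _ => ?_
    -- The diagonal product omits slot j; the factor ρ of the bottom row restores the full power
    -- ρ^N.
    have e1 : ∏ i, (if i = j then 1 else ρ * c i) * (if i = j then ρ else 1)
        = ρ ^ N * ∏ i, (if i = j then 1 else c i) := by
      have hN : ρ ^ N = ∏ _i : Fin N, ρ := by simp
      rw [hN, ← Finset.prod_mul_distrib]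
      refine Finset.prod_congr rfl fun i _ => ?_
      split_ifs <;> ring
    rw [Finset.prod_mul_distrib, Finset.prod_ite_eq' Finset.univ j, if_pos (Finset.mem_univ j)]
      at e1
    have e2 : ∏ i, (if i = j then s i ^ 2 else c i ^ 2)
        = s j ^ 2 * (∏ i, if i = j then 1 else c i) ^ 2 := by
      rw [← Finset.prod_pow, ← Finset.mul_prod_erase Finset.univ _ (Finset.mem_univ j), if_pos rfl,
        prod_erase_eq_prod_ite]
      congr 1
      refine Finset.prod_congr rfl fun i _ => ?_
      split_ifs <;> ring
    change _ = _ * ∏ i, (if i = j then s i ^ 2 else c i ^ 2)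
    rw [e2, cutoffJac]
    linear_combination ρ' * s j ^ 2 * (∏ i, if i = j then 1 else c i) * e1

theorem sum_jacobian_waveDeriv (p : Euc (N + 1)) :
    ∑ S : Fin N → Bool, jacobian (waveDeriv S p) = (N + 1) * cutoffJac N (p (Fin.last N)) := by
  simp only [jacobian_waveDeriv]
  rw [← Finset.mul_sum, sum_prod_phase fun i => p (Fin.castSucc i), mul_comm]

/-! ### Self-similar extension to the half-space -/

/-- The largest power of `4` that is at most `t`, for `t > 0`. -/
def scale (t : ℝ) : ℝ := (4 : ℝ) ^ Int.log 4 t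

theorem scale_pos (t : ℝ) : 0 < scale t := by unfold scale; positivity

theorem scale_le {t : ℝ} (ht : 0 < t) : scale t ≤ t := by
  simpa [scale] using Int.zpow_log_le_self (b := 4) (by norm_num) ht

theorem lt_four_mul_scale (t : ℝ) : t < 4 * scale t := by
  have := Int.lt_zpow_succ_log_self (b := 4) (by norm_num) t
  rw [zpow_add_one₀ (by norm_num)] at this
  simpa [scale, mul_comm] using this

theorem scale_eq {t : ℝ} {L : ℤ} (h1 : (4 : ℝ) ^ L ≤ t) (h2 : t < 4 * (4 : ℝ) ^ L) :
    scale t = 4 ^ L := by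
  have ht : 0 < t := lt_of_lt_of_le (by positivity) h1
  have e1 : L ≤ Int.log 4 t := (Int.zpow_le_iff_le_log (by norm_num) ht).1 (by simpa using h1)
  have e2 : Int.log 4 t < L + 1 := by
    refine (Int.lt_zpow_iff_log_lt (by norm_num) ht).1 ?_
    rw [zpow_add_one₀ (by norm_num)]
    simpa [mul_comm] using h2
  rw [scale, show Int.log 4 t = L by omega]

theorem scale_eq_scale {t u : ℝ} (h1 : scale u ≤ t) (h2 : t < 4 * scale u) :
    scale t = scale u := scale_eq h1 h2

theorem scale_eq_four_mul_scale {t u : ℝ} (h1 : 4 * scale u ≤ t) (h2 : t < 4 * (4 * scale u)) :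
    scale t = 4 * scale u := by
  have h : 4 * scale u = (4 : ℝ) ^ (Int.log 4 u + 1) := by
    rw [zpow_add_one₀ (by norm_num), scale, mul_comm]
  rw [h] at h1 h2 ⊢
  exact scale_eq h1 h2

theorem scale_eq_scale_div_four {t u : ℝ} (h1 : scale u / 4 ≤ t) (h2 : t < scale u) :
    scale t = scale u / 4 := by
  have h : scale u / 4 = (4 : ℝ) ^ (Int.log 4 u - 1) := by
    rw [zpow_sub_one₀ (by norm_num), scale, div_eq_mul_inv]
  rw [h] at h1 ⊢
  refine scale_eq h1 ?_
  rw [← h]; linarith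

/-- The self-similar extension of `wave` to the upper half-space, extended by zero. -/
def tower (S : Fin N → Bool) (p : Euc (N + 1)) : Euc (N + 1) :=
  if 0 < p (Fin.last N) then
    scale (p (Fin.last N)) ^ 6 • wave S ((scale (p (Fin.last N)))⁻¹ • p) else 0

/-- The differential of `tower`. -/
def towerDeriv (S : Fin N → Bool) (p : Euc (N + 1)) : Euc (N + 1) →L[ℝ] Euc (N + 1) :=
  if 0 < p (Fin.last N) then
    scale (p (Fin.last N)) ^ 5 • waveDeriv S ((scale (p (Fin.last N)))⁻¹ • p) else 0

theorem last_le_norm (p : Euc (N + 1)) : p (Fin.last N) ≤ ‖p‖ :=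
  (le_abs_self _).trans (PiLp.norm_apply_le p _)

theorem norm_towerDeriv_le (S : Fin N → Bool) (p : Euc (N + 1)) :
    ‖towerDeriv S p‖ ≤ 28 * (N + 1) ^ 2 * ‖p‖ ^ 5 := by
  unfold towerDeriv
  split_ifs with h
  · have hs := scale_pos (p (Fin.last N))
    rw [norm_smul, norm_pow, Real.norm_of_nonneg hs.le, mul_comm]
    gcongr
    · exact norm_waveDeriv_le S _
    · exact (scale_le h).trans (last_le_norm p)
  · rw [norm_zero]; positivity

theorem tower_eq_zero (S : Fin N → Bool) {p : Euc (N + 1)} (h : p (Fin.last N) ≤ 0) :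
    tower S p = 0 := if_neg (not_lt.2 h)

/-- The scale at p is at most its height, which is at most the distance to any point of the lower
half-space. This gives differentiability with zero differential there. -/
theorem norm_tower_le (S : Fin N → Bool) {p q : Euc (N + 1)} (hq : q (Fin.last N) ≤ 0) :
    ‖tower S p‖ ≤ (N + 1) * 14 * ‖p - q‖ ^ 6 := by
  unfold tower
  split_ifs with h
  · have hs := scale_pos (p (Fin.last N))
    rw [norm_smul, norm_pow, Real.norm_of_nonneg hs.le, mul_comm]
    gcongr
    · exact norm_wave_le S _
    · refine (scale_le h).trans (le_trans ?_ (last_le_norm (p - q)))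
      simp [hq]
  · rw [norm_zero]; positivity

theorem hasFDerivAt_scaled_wave (S : Fin N → Bool) (p : Euc (N + 1)) {s : ℝ} (hs : s ≠ 0) :
    HasFDerivAt (fun p => s ^ 6 • wave S (s⁻¹ • p)) (s ^ 5 • waveDeriv S (s⁻¹ • p)) p := by
  have h1 : HasFDerivAt (fun p : Euc (N + 1) => s⁻¹ • p)
      (s⁻¹ • ContinuousLinearMap.id ℝ (Euc (N + 1))) p := (hasFDerivAt_id p).const_smul s⁻¹
  refine (((hasFDerivAt_wave S (s⁻¹ • p)).comp p h1).const_smul (s ^ 6)).congr_fderiv ?_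
  rw [ContinuousLinearMap.comp_smul, ContinuousLinearMap.comp_id, smul_smul]
  congr 1
  field_simp

theorem hasFDerivAt_tower (S : Fin N → Bool) (p : Euc (N + 1)) :
    HasFDerivAt (tower S) (towerDeriv S p) p := by
  rcases le_or_gt (p (Fin.last N)) 0 with ht | ht
  · rw [towerDeriv, if_neg (not_lt.2 ht)]
    refine Asymptotics.IsBigO.hasFDerivAt (n := 6) (Asymptotics.IsBigO.of_bound ((N + 1) * 14) ?_)
      (by norm_num)
    refine Filter.Eventually.of_forall fun q => ?_
    simpa using norm_tower_le S (p := q) ht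
  · set s := scale (p (Fin.last N)) with hs
    have hs0 : 0 < s := scale_pos _
    have h4 : p (Fin.last N) < 4 * s := lt_four_mul_scale _
    have h1 : s ≤ p (Fin.last N) := scale_le ht
    have hz : waveDeriv S ((s / 4)⁻¹ • p) = 0 := by
      refine waveDeriv_eq_zero S (Or.inr ?_)
      simp only [PiLp.smul_apply, smul_eq_mul]
      rw [inv_mul_eq_div, le_div_iff₀ (by positivity)]
      linarith
    -- For heights in (s/4, 4s) the tower equals the sum of the waves of scales s and s/4, since
    -- each vanishes on the other's slab. This also covers the interface t = s; the s/4 wave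
    -- contributes nothing to the differential at p.
    have hsum := (hasFDerivAt_scaled_wave S p hs0.ne').add
      (hasFDerivAt_scaled_wave S p (s := s / 4) (by positivity))
    have hz' : (s / 4) ^ 5 • waveDeriv S ((s / 4)⁻¹ • p) = 0 := by
      rw [hz]; ext v; simp
    rw [hz', add_zero] at hsum
    rw [towerDeriv, if_pos ht, ← hs]
    refine hsum.congr_of_eventuallyEq ?_
    have hcont : Continuous fun q : Euc (N + 1) => q (Fin.last N) := by fun_prop
    filter_upwards [hcont.continuousAt.eventually (lt_mem_nhds (show s / 4 < _ by linarith)),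
      hcont.continuousAt.eventually (gt_mem_nhds h4)] with q hq1 hq2
    rw [tower, if_pos (by linarith), Pi.add_apply]
    rcases le_or_gt s (q (Fin.last N)) with h | h
    · rw [scale_eq_scale (u := p (Fin.last N)) h hq2, ← hs,
        wave_eq_zero S (p := (s / 4)⁻¹ • q), smul_zero, add_zero]
      refine Or.inr ?_
      simp only [PiLp.smul_apply, smul_eq_mul]
      rw [inv_mul_eq_div, le_div_iff₀ (by positivity)]
      linarith
    · rw [scale_eq_scale_div_four (u := p (Fin.last N)) hq1.le h, ← hs,
        wave_eq_zero S (p := s⁻¹ • q), smul_zero, zero_add]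
      refine Or.inl ?_
      simp only [PiLp.smul_apply, smul_eq_mul]
      rw [inv_mul_eq_div, div_le_iff₀ (by positivity)]
      linarith

/-! ### Two interlaced towers -/

/-- The components of the curve: two interlaced copies of each `tower`. -/
def component (i : Bool × (Fin N → Bool)) (p : Euc (N + 1)) : Euc (N + 1) :=
  if i.1 then (1 / 64 : ℝ) • tower i.2 ((2 : ℝ) • p) else tower i.2 p

/-- The differentials of the components. -/
def componentDeriv (i : Bool × (Fin N → Bool)) (p : Euc (N + 1)) :
    Euc (N + 1) →L[ℝ] Euc (N + 1) :=
  if i.1 then (1 / 32 : ℝ) • towerDeriv i.2 ((2 : ℝ) • p) else towerDeriv i.2 p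

theorem hasFDerivAt_component (i : Bool × (Fin N → Bool)) (p : Euc (N + 1)) :
    HasFDerivAt (component i) (componentDeriv i p) p := by
  rcases i with ⟨b, S⟩
  cases b
  · exact hasFDerivAt_tower S p
  · have h1 : HasFDerivAt (fun p : Euc (N + 1) => (2 : ℝ) • p)
        ((2 : ℝ) • ContinuousLinearMap.id ℝ (Euc (N + 1))) p := (hasFDerivAt_id p).const_smul (2 : ℝ)
    refine (((hasFDerivAt_tower S ((2 : ℝ) • p)).comp p h1).const_smul (1 / 64 : ℝ)).congr_fderiv ?_
    rw [ContinuousLinearMap.comp_smul, ContinuousLinearMap.comp_id, smul_smul, componentDeriv,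
      if_pos rfl]
    norm_num

theorem component_eq_zero (i : Bool × (Fin N → Bool)) {p : Euc (N + 1)}
    (h : p (Fin.last N) ≤ 0) : component i p = 0 := by
  have h2 : ((2 : ℝ) • p) (Fin.last N) ≤ 0 := by
    simp only [PiLp.smul_apply, smul_eq_mul]; linarith
  simp [component, tower_eq_zero i.2 h, tower_eq_zero i.2 h2]

theorem norm_componentDeriv_le (i : Bool × (Fin N → Bool)) (p : Euc (N + 1)) :
    ‖componentDeriv i p‖ ≤ 28 * (N + 1) ^ 2 * ‖p‖ ^ 5 := by
  unfold componentDeriv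
  split_ifs
  · have := norm_towerDeriv_le i.2 ((2 : ℝ) • p)
    rw [norm_smul, Real.norm_of_nonneg zero_le_two, mul_pow] at this
    rw [norm_smul]
    norm_num
    linarith
  · exact norm_towerDeriv_le i.2 p

theorem sum_jacobian_smul (w : ℝ) (p : Euc (N + 1)) :
    ∑ S : Fin N → Bool, jacobian (w • waveDeriv S p)
      = w ^ (N + 1) * ((N + 1) * cutoffJac N (p (Fin.last N))) := by
  simp only [jacobian_smul]
  rw [← Finset.mul_sum, sum_jacobian_waveDeriv]

theorem norm_smul_waveDeriv_le (S : Fin N → Bool) (p : Euc (N + 1)) {v w : ℝ} (hv : 0 ≤ v)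
    (hvw : v ≤ w) : ‖v • waveDeriv S p‖ ≤ w * (28 * (N + 1) ^ 2) := by
  rw [norm_smul, Real.norm_of_nonneg hv]
  exact mul_le_mul hvw (norm_waveDeriv_le S p) (norm_nonneg _) (hv.trans hvw)

/-- On the two halves of a slab the towers swap roles. In each, the dominant one is evaluated at
some u in [1, 2] with weight w and the other at 2u with weight w/32, so the same bound `hδ` applies.
-/
theorem componentDeriv_estimate {δ : ℝ} (hδ : ∀ t : ℝ, 1 ≤ t → t ≤ 2 →
      δ ≤ cutoffJac N t + (1 / 32) ^ (N + 1) * cutoffJac N (2 * t))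
    {p : Euc (N + 1)} (hp : 0 < p (Fin.last N)) :
    ∃ w : ℝ, 0 < w ∧ (∀ i, ‖componentDeriv i p‖ ≤ w * (28 * (N + 1) ^ 2)) ∧
      w ^ (N + 1) * ((N + 1) * δ) ≤ ∑ i, jacobian (componentDeriv i p) := by
  set t := p (Fin.last N) with ht
  set s := scale t with hs
  have hs0 : 0 < s := scale_pos _
  have h1 : s ≤ t := scale_le hp
  have h4 : t < 4 * s := lt_four_mul_scale _
  have hp2 : ((2 : ℝ) • p) (Fin.last N) = 2 * t := rfl
  have hD0 : ∀ S, componentDeriv (false, S) p = s ^ 5 • waveDeriv S (s⁻¹ • p) :=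
    fun S => if_pos hp
  have hsmul : ∀ r : ℝ, (r • p) (Fin.last N) = r * t := fun r => rfl
  rw [Fintype.sum_prod_type]
  simp only [Fintype.univ_bool, Finset.sum_insert (show true ∉ ({false} : Finset Bool) by simp),
    Finset.sum_singleton]
  rcases lt_or_ge (2 * t) (4 * s) with h | h
  · have hsc : scale (2 * t) = s := scale_eq_scale (by linarith) h
    have hD1 : ∀ S, componentDeriv (true, S) p
        = (1 / 32 * s ^ 5) • waveDeriv S ((s⁻¹ * 2) • p) := fun S => by
      rw [componentDeriv, if_pos rfl, towerDeriv, hp2, if_pos (by linarith), hsc, smul_smul,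
        smul_smul]
    refine ⟨s ^ 5, by positivity, ?_, ?_⟩
    · rintro ⟨_ | _, S⟩
      · rw [hD0]
        exact norm_smul_waveDeriv_le S _ (by positivity) le_rfl
      · rw [hD1]
        exact norm_smul_waveDeriv_le S _ (by positivity) (by nlinarith [pow_pos hs0 5])
    · simp only [hD0, hD1, sum_jacobian_smul, hsmul]
      have := hδ (s⁻¹ * t) (by rw [inv_mul_eq_div, le_div_iff₀ hs0]; linarith)
        (by rw [inv_mul_eq_div, div_le_iff₀ hs0]; linarith)
      calc (s ^ 5) ^ (N + 1) * ((N + 1) * δ)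
          ≤ (s ^ 5) ^ (N + 1) * ((N + 1) * (cutoffJac N (s⁻¹ * t)
              + (1 / 32) ^ (N + 1) * cutoffJac N (2 * (s⁻¹ * t)))) := by gcongr
        _ = _ := by
            rw [mul_pow (1 / 32 : ℝ), show s⁻¹ * 2 * t = 2 * (s⁻¹ * t) by ring]; ring
  · have hsc : scale (2 * t) = 4 * s := scale_eq_four_mul_scale h (by linarith)
    have hD1 : ∀ S, componentDeriv (true, S) p
        = (32 * s ^ 5) • waveDeriv S (((4 * s)⁻¹ * 2) • p) := fun S => by
      rw [componentDeriv, if_pos rfl, towerDeriv, hp2, if_pos (by linarith), hsc, smul_smul,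
        smul_smul]
      congr 1; ring
    -- The dilated tower has moved on to scale 4s, and 32 = 4⁵/32.
    refine ⟨32 * s ^ 5, by positivity, ?_, ?_⟩
    · rintro ⟨_ | _, S⟩
      · rw [hD0]
        exact norm_smul_waveDeriv_le S _ (by positivity) (by nlinarith [pow_pos hs0 5])
      · rw [hD1]
        exact norm_smul_waveDeriv_le S _ (by positivity) le_rfl
    · simp only [hD0, hD1, sum_jacobian_smul, hsmul]
      have e : (4 * s)⁻¹ * 2 * t = t / (2 * s) := by field_simp; norm_num
      have := hδ (t / (2 * s)) (by rw [le_div_iff₀ (by positivity)]; linarith)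
        (by rw [div_le_iff₀ (by positivity)]; linarith)
      calc (32 * s ^ 5) ^ (N + 1) * ((N + 1) * δ)
          ≤ (32 * s ^ 5) ^ (N + 1) * ((N + 1) * (cutoffJac N (t / (2 * s))
              + (1 / 32) ^ (N + 1) * cutoffJac N (2 * (t / (2 * s))))) := by gcongr
        _ = _ := by
            have e2 : 2 * (t / (2 * s)) = s⁻¹ * t := by field_simp
            have e3 : (32 : ℝ) ^ (N + 1) * (1 / 32) ^ (N + 1) = 1 := by
              rw [← mul_pow]; norm_num
            rw [e, e2, mul_pow (32 : ℝ)]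
            linear_combination (s ^ 5) ^ (N + 1) * ((N + 1) * cutoffJac N (s⁻¹ * t)) * e3

/-! ### Sobolev regularity of differentiable maps -/

section Sobolev

variable {n : ℕ} {V : Type*} [NormedAddCommGroup V] [InnerProductSpace ℝ V]

theorem memLp_restrict_of_continuous {W : Type*} [NormedAddCommGroup W] (p : ℝ≥0∞)
    {f : Euc n → W} (hf : Continuous f) {S : Set (Euc n)} (hS : IsCompact S) :
    MemLp f p (volume.restrict S) := by
  have : IsFiniteMeasure (volume.restrict S) := ⟨by simpa using hS.measure_lt_top⟩
  obtain ⟨C, hC⟩ := hS.exists_bound_of_continuousOn hf.continuousOn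
  exact MemLp.of_bound
    hf.aestronglyMeasurable C
    (ae_restrict_of_forall_mem hS.measurableSet hC)

theorem continuous_of_hasFDerivAt {F : Euc n → V} {F' : Euc n → Euc n →L[ℝ] V}
    (hF : ∀ x, HasFDerivAt F (F' x) x) : Continuous F :=
  continuous_iff_continuousAt.2 fun x => (hF x).continuousAt

/-- A differentiable map whose differential is dominated by a continuous function belongs to all
local Sobolev spaces `W^{1,p}_loc`. -/
theorem memSobolevLocWith_of_hasFDerivAt [FiniteDimensional ℝ V] (p : ℝ≥0∞)
    {F : Euc n → V} {F' : Euc n → Euc n →L[ℝ] V}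
    (hF' : ∀ x, HasFDerivAt F (F' x) x) {g : Euc n → ℝ} (hg : Continuous g)
    (hFg : ∀ x, ‖F' x‖ ≤ g x) : MemSobolevLocWith p F F' := by
  have hF : Differentiable ℝ F := fun x => (hF' x).differentiableAt
  obtain rfl : fderiv ℝ F = F' := funext fun x => (hF' x).fderiv
  -- A derivative is measurable without being continuous, so the bound by `g` is enough for local
  -- integrability.
  have hmeas : AEStronglyMeasurable (fderiv ℝ F) (volume : Measure (Euc n)) := by
    borelize (Euc n →L[ℝ] V)
    exact (measurable_fderiv ℝ F).aestronglyMeasurable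
  have hbound : ∀ x, ‖fderiv ℝ F x‖ ≤ ‖g x‖ := fun x => (hFg x).trans (Real.le_norm_self _)
  have hlocD : LocallyIntegrable (fderiv ℝ F) volume :=
    hg.locallyIntegrable.mono hmeas (Filter.Eventually.of_forall hbound)
  refine ⟨⟨hF.continuous.locallyIntegrable, hlocD, ?_⟩,
    fun S hS => memLp_restrict_of_continuous p hF.continuous hS,
    fun S hS => ?_⟩
  · intro φ hφ hsupp v
    have hφ1 : Differentiable ℝ φ := hφ.differentiable (by simp)
    have hφc : Continuous fun x => fderiv ℝ φ x v :=
      (hφ.continuous_fderiv (by simp)).clm_apply continuous_const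
    have hsupp' : HasCompactSupport fun x => fderiv ℝ φ x v := hsupp.fderiv_apply (𝕜 := ℝ) v
    have h1 : Integrable (fun x => fderiv ℝ φ x v • F x) volume :=
      (hφc.smul hF.continuous).integrable_of_hasCompactSupport hsupp'.smul_right
    have h2 : Integrable (fun x => φ x • fderiv ℝ F x v) volume := by
      have := hlocD.integrable_smul_left_of_hasCompactSupport hφ1.continuous hsupp
      exact (ContinuousLinearMap.apply ℝ V v).integrable_comp this
    have h3 : Integrable (fun x => φ x • F x) volume :=
      (hφ1.continuous.smul hF.continuous).integrable_of_hasCompactSupport hsupp.smul_right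
    rw [integral_smul_fderiv_eq_neg_fderiv_smul_of_integrable h1 h2 h3 (fun x _ => hφ1 x)
      (fun x _ => hF x), neg_neg]
  · exact (memLp_restrict_of_continuous p hg hS).mono hmeas.restrict (Filter.Eventually.of_forall hbound)

end Sobolev

/-! ### The curve and its distortion -/

theorem hodgeStar_volProd {n k : ℕ} (y : EucProd n k) (T : Euc n →L[ℝ] EucProd n k) :
    hodgeStar ((volProd n k y).compContinuousLinearMap T)
      = ∑ i, jacobian ((PiLp.proj 2 (fun _ : Fin k => Euc n) i) ∘L T) := by
  simp only [hodgeStar, volProd, ContinuousAlternatingMap.compContinuousLinearMap_apply,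
    ContinuousAlternatingMap.sum_apply]
  rfl

theorem volForm_basisFun (n : ℕ) :
    volForm n (fun i => EuclideanSpace.basisFun (Fin n) ℝ i) = 1 := by
  change (EuclideanSpace.basisFun (Fin n) ℝ).toBasis.det _ = 1
  rw [← OrthonormalBasis.coe_toBasis, Module.Basis.det_self]

theorem volProd_ne_zero {n k : ℕ} (hk : k ≠ 0) (y : EucProd n k) : volProd n k y ≠ 0 := by
  intro h
  have h1 : volProd n k y (fun i => WithLp.toLp 2 fun _ => EuclideanSpace.basisFun (Fin n) ℝ i)
      = k := by
    simp only [volProd, ContinuousAlternatingMap.compContinuousLinearMap_apply,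
      ContinuousAlternatingMap.sum_apply]
    exact (Finset.sum_congr rfl fun i _ => volForm_basisFun n).trans (by simp)
  rw [h] at h1
  exact hk (Nat.cast_eq_zero.1 h1.symm)

variable {k : ℕ} (e : Fin k ≃ Bool × (Fin N → Bool))

theorem card_pos_of_equiv {N k : ℕ} (e : Fin k ≃ Bool × (Fin N → Bool)) : 0 < k := by
  rcases Nat.eq_zero_or_pos k with rfl | h
  · exact (e.symm (true, fun _ => true)).elim0
  · exact h

/-- A quasiregular curve which vanishes in the lower half-space. -/
def curve (p : Euc (N + 1)) : EucProd (N + 1) k :=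
  WithLp.toLp 2 fun i => component (e i) p

/-- The differential of `curve`. -/
def curveDeriv (p : Euc (N + 1)) :
    Euc (N + 1) →L[ℝ] EucProd (N + 1) k :=
  ((PiLp.continuousLinearEquiv 2 ℝ fun _ : Fin k => Euc (N + 1)).symm :
    _ →L[ℝ] EucProd (N + 1) k) ∘L
    ContinuousLinearMap.pi fun i => componentDeriv (e i) p

theorem proj_comp_curveDeriv (p : Euc (N + 1)) (i : Fin k) :
    (PiLp.proj 2 (fun _ : Fin k => Euc (N + 1)) i) ∘L curveDeriv e p
      = componentDeriv (e i) p := by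
  ext v; rfl

theorem hasFDerivAt_curve (p : Euc (N + 1)) : HasFDerivAt (curve e) (curveDeriv e p) p := by
  rw [← hasFDerivWithinAt_univ, hasFDerivWithinAt_piLp]
  intro i
  rw [hasFDerivWithinAt_univ, proj_comp_curveDeriv]
  exact hasFDerivAt_component _ p

theorem norm_curveDeriv_le {p : Euc (N + 1)} {C : ℝ} (hC : 0 ≤ C)
    (h : ∀ i, ‖componentDeriv i p‖ ≤ C) : ‖curveDeriv e p‖ ≤ k * C := by
  refine ContinuousLinearMap.opNorm_le_bound _ (by positivity) fun v => ?_
  calc ‖curveDeriv e p v‖ ≤ ∑ i, ‖componentDeriv (e i) p v‖ := norm_le_sum_norm _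
    _ ≤ ∑ _i : Fin k, C * ‖v‖ :=
      Finset.sum_le_sum fun i _ => (ContinuousLinearMap.le_opNorm _ v).trans (by gcongr; exact h _)
    _ = _ := by
      rw [Finset.sum_const, Finset.card_univ, Fintype.card_fin, nsmul_eq_mul, mul_assoc]

theorem hodgeStar_curve (y : EucProd (N + 1) k) (p : Euc (N + 1)) :
    hodgeStar ((volProd (N + 1) k y).compContinuousLinearMap (curveDeriv e p))
      = ∑ i, jacobian (componentDeriv i p) := by
  rw [hodgeStar_volProd]
  simp only [proj_comp_curveDeriv]
  exact e.sum_comp fun i => jacobian (componentDeriv i p)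

/-- Both sides vanish on the lower half-space. Above it both are controlled by w^(N+1), with w from
`componentDeriv_estimate`, so the weight cancels and C does not depend on p. -/
theorem curve_distortion : ∃ C : ℝ, 0 < C ∧ ∀ p : Euc (N + 1),
    ‖curveDeriv e p‖ ^ (N + 1) ≤ C * ∑ i, jacobian (componentDeriv i p) := by
  obtain ⟨δ, hδ0, hδ⟩ := exists_le_cutoffJac_add N
  refine ⟨(k * (28 * (N + 1) ^ 2)) ^ (N + 1) / ((N + 1) * δ), ?_,
    fun p => ?_⟩
  · have := card_pos_of_equiv e
    positivity
  rcases le_or_gt (p (Fin.last N)) 0 with hp | hp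
  · have hz : ∀ i : Bool × (Fin N → Bool), componentDeriv i p = 0 := by
      have hp2 : ((2 : ℝ) • p) (Fin.last N) ≤ 0 := by
        simp only [PiLp.smul_apply, smul_eq_mul]; linarith
      intro i
      rw [componentDeriv, towerDeriv, towerDeriv, if_neg hp2.not_gt, if_neg hp.not_gt]
      split_ifs
      · ext v; simp
      · rfl
    have hc : curveDeriv e p = 0 := by
      have := norm_curveDeriv_le e le_rfl (fun i => (norm_le_zero_iff.2 (hz i)))
      rw [mul_zero] at this
      exact norm_le_zero_iff.1 this
    have hj : jacobian (0 : Euc (N + 1) →L[ℝ] Euc (N + 1)) = 0 := by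
      have := jacobian_smul (0 : ℝ) (0 : Euc (N + 1) →L[ℝ] Euc (N + 1))
      rw [show (0 : ℝ) • (0 : Euc (N + 1) →L[ℝ] Euc (N + 1)) = 0 by ext; simp] at this
      rw [this]; simp
    simp [hz, hc, hj]
  · obtain ⟨w, hw, hnorm, hjac⟩ := componentDeriv_estimate hδ hp
    have hn := norm_curveDeriv_le e (by positivity) hnorm
    calc ‖curveDeriv e p‖ ^ (N + 1)
        ≤ (k * (w * (28 * (N + 1) ^ 2))) ^ (N + 1) := by gcongr
      _ = (k * (28 * (N + 1) ^ 2)) ^ (N + 1) / ((N + 1) * δ)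
          * (w ^ (N + 1) * ((N + 1) * δ)) := by
        rw [mul_left_comm, mul_pow w]
        field_simp
      _ ≤ _ := by gcongr

theorem extDeriv_volProd {n k : ℕ} (y : EucProd n k) : extDeriv (volProd n k) y = 0 := by
  have h : fderiv ℝ (volProd n k) y = 0 := fderiv_const_apply (volProd n k y)
  rw [extDeriv, h]
  exact map_zero (ContinuousAlternatingMap.alternatizeUncurryFinCLM ℝ (EucProd n k) ℝ)

theorem memSobolevLocWith_curve (q : ℝ≥0∞) :
    MemSobolevLocWith q (curve e) (curveDeriv e) := by
  refine memSobolevLocWith_of_hasFDerivAt q (hasFDerivAt_curve e)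
    (g := fun p => k * (28 * (N + 1) ^ 2 * ‖p‖ ^ 5))
    (continuous_const.mul (continuous_const.mul (continuous_norm.pow 5))) fun p => ?_
  exact norm_curveDeriv_le e (by positivity) fun i => norm_componentDeriv_le i p

theorem contDiff_volProd (n k : ℕ) : ContDiff ℝ (⊤ : ℕ∞) (volProd n k) :=
  contDiff_const (c := volProd n k 0)

theorem continuous_curve : Continuous (curve e) :=
  continuous_of_hasFDerivAt (hasFDerivAt_curve e)

/-- Serves to absorb the comass M, constant since the form has constant coefficients, into K without
computing it. Replacing the constant by a larger one is harmless because J ≥ 0 is forced. -/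
theorem mul_le_max_one_abs_mul {M x C J : ℝ} (hC : 0 < C) (hx : 0 ≤ x) (h : x ≤ C * J) :
    M * x ≤ max 1 (|M| * C) * J := by
  have hJ : 0 ≤ J := nonneg_of_mul_nonneg_right (hx.trans h) hC
  calc M * x ≤ |M| * x := by gcongr; exact le_abs_self M
    _ ≤ |M| * (C * J) := by gcongr
    _ = |M| * C * J := by ring
    _ ≤ _ := by gcongr; exact le_max_right _ _

theorem isQuasiregularCurve_curve :
    IsQuasiregularCurve (volProd (N + 1) k) (curve e) := by
  obtain ⟨C, hC0, hC⟩ := curve_distortion e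
  refine ⟨max 1 (|comass (volProd (N + 1) k 0)| * C), ?_⟩
  constructor
  · exact le_max_left _ _
  · exact contDiff_volProd _ _
  · exact extDeriv_volProd
  · exact volProd_ne_zero (card_pos_of_equiv e).ne'
  · exact continuous_curve e
  · refine ⟨curveDeriv e, memSobolevLocWith_curve e _, Filter.Eventually.of_forall fun p => ?_⟩
    rw [hodgeStar_curve]
    exact mul_le_max_one_abs_mul hC0 (pow_nonneg (norm_nonneg _) _) (hC p)

theorem curve_eq_zero {p : Euc (N + 1)} (h : p (Fin.last N) ≤ 0) : curve e p = 0 := by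
  exact WithLp.ofLp_injective 2 (funext fun i => component_eq_zero _ h)

theorem exists_curve_ne_zero : ∃ p, curve e p ≠ 0 := by
  -- At height 2 the scale is 1, and with x = 0 and no phase shift all cosines are 1, so the last
  -- coordinate is `cutoff 2` = 4.
  refine ⟨EuclideanSpace.single (Fin.last N) 2, fun h => ?_⟩
  have h1 : component ((false, fun _ => false) : Bool × (Fin N → Bool))
      (EuclideanSpace.single (Fin.last N) 2) = 0 := by
    have := congrArg (fun q : EucProd (N + 1) k =>
      q (e.symm (false, fun _ => false))) h
    simpa [curve] using this
  have hs : scale 2 = 1 := by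
    have := scale_eq (t := 2) (L := 0) (by norm_num) (by norm_num)
    simpa using this
  have hne : ∀ x : Fin N, x.castSucc ≠ Fin.last N := fun x => (Fin.castSucc_lt_last x).ne
  have h2 := congrArg (fun q : Euc (N + 1) => q (Fin.last N)) h1
  simp [component, tower, hs, wave, waveCoord, phase, cutoff, hne] at h2
  norm_num at h2

/-! ### Non-discreteness -/

/-- A discrete fiber is totally disconnected, but the fiber over c contains the convex half-space,
in which 0 and minus the last basis vector are distinct. -/
theorem not_isDiscreteMap {n : ℕ} (hn : n ≠ 0) {Y : Type*} {F : Euc n → Y}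
    (h : IsConstantOn F (lowerHalfSpace n)) : ¬ IsDiscreteMap F := by
  intro hd
  obtain ⟨c, hc⟩ := h
  have := hd c
  have htd : IsTotallyDisconnected (F ⁻¹' {c}) :=
    totallyDisconnectedSpace_subtype_iff.1 inferInstance
  have hconv : Convex ℝ (lowerHalfSpace n) := by
    intro x hx y hy a b ha hb _ i hi
    have h1 := mul_nonpos_of_nonneg_of_nonpos ha (hx i hi)
    have h2 := mul_nonpos_of_nonneg_of_nonpos hb (hy i hi)
    simp only [PiLp.add_apply, PiLp.smul_apply, smul_eq_mul]
    linarith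
  have hsub := htd _ (fun x hx => hc x hx) hconv.isPreconnected
  obtain ⟨m, rfl⟩ := Nat.exists_eq_succ_of_ne_zero hn
  have hmem : -EuclideanSpace.single (Fin.last m) (1 : ℝ) ∈ lowerHalfSpace (m + 1) := by
    intro i _
    by_cases hi : i = Fin.last m <;> simp [hi]
  have h0 := hsub hmem (show (0 : Euc (m + 1)) ∈ lowerHalfSpace (m + 1) from fun i _ => by simp)
  simpa using congrArg norm h0

end QRCurve

end

theorem mainTheorem11 (n : ℕ) (hn : 3 ≤ n) :
    (∃ (k : ℕ) (F : QRCurve.Euc n → QRCurve.EucProd n k),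
      QRCurve.IsQuasiregularCurve (QRCurve.volProd n k) F ∧
      ¬ QRCurve.IsConstantOn F Set.univ ∧
      QRCurve.IsConstantOn F (QRCurve.lowerHalfSpace n)) ∧
    (∀ (k : ℕ) (F : QRCurve.Euc n → QRCurve.EucProd n k),
      QRCurve.IsQuasiregularCurve (QRCurve.volProd n k) F →
      ¬ QRCurve.IsConstantOn F Set.univ →
      QRCurve.IsConstantOn F (QRCurve.lowerHalfSpace n) →
      ¬ QRCurve.IsDiscreteMap F) := by
  refine ⟨?_, fun k F _ _ hF => QRCurve.not_isDiscreteMap (by omega) hF⟩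
  obtain ⟨N, rfl⟩ : ∃ N, n = N + 1 := ⟨n - 1, by omega⟩
  -- The number of factors is k = 2 · 2^N = 2^n: two towers for each choice of phases.
  let e := (Fintype.equivFin (Bool × (Fin N → Bool))).symm
  refine ⟨_, QRCurve.curve e, QRCurve.isQuasiregularCurve_curve e, ?_,
    0, fun p hp => QRCurve.curve_eq_zero e (hp (Fin.last N) (by simp))⟩
  rintro ⟨c, hc⟩
  obtain ⟨p, hp⟩ := QRCurve.exists_curve_ne_zero e
  apply hp
  rw [hc p trivial, ← hc 0 trivial]
  exact QRCurve.curve_eq_zero e (by simp)
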